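/- Let $G$ be a finite simple graph with maximum degree $\Delta(G)$ and minimum degree $\delta(G)$. For a positive integer $k$, a majority additive $k$-coloring of $G$ is a function $c:V(G)\to\{1,\ldots,k\}$ such that, with $s_c(v)=\sum_{w\in N_G(v)}c(w)$, there are no vertex $u$ of degree at least $2$ and no integer $s$ with $s_c(v)=s$ for more than half the neighbors $v$ of $u$. The majority additive chromatic number $\chi_{mac}(G)$ is the smallest positive integer $k$ such that $G$ has a majority additive $k$-coloring ($\infty$ if there is none). The graph $G$ is good if there are no vertex $u$ with $d_G(u)>1$ and no set $R\subseteq N_G(u)$ with $2|R|>d_G(u)$ such that $N_G(v)=N_G(w)$ for all $v,w\in R$. The graph $G$ satisfies the private neighbor condition if for every vertex $u$ with $d_G(u)\geq 2$ and every $v\in N_G(u)$ there is some $w\in N_G(v)$ with $N_G(w)\cap (N_G(u)\cup\{u\})=\{v\}$. Corollary. If $G$ satisfies the private neighbor condition and $\delta(G)\in\Omega(\log\Delta(G))$, then $G$ is good and $\chi_{mac}(G)$ is bounded by a constant. That is: for every real $\varepsilon>0$ and every non-negative integer $\Delta_0$ there is a constant $C$, depending only on $\varepsilon$ and $\Delta_0$,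 such that every finite simple graph $G$ that satisfies the private neighbor condition and for which $\Delta(G)\geq\Delta_0$ implies $\delta(G)\geq\varepsilon\log\Delta(G)$ (with the convention $\log 0=0$ for graphs without edges) is good and satisfies $\chi_{mac}(G)\leq C$. -/

import Mathlib

open scoped Finset

namespace MajorityAdditive

variable {V : Type*} [Fintype V] (G : SimpleGraph V) [DecidableRel G.Adj]

/-- The value `s_c(u) = ∑_{v ∈ N_G(u)} c(v)`. -/
def neighborSum (c : V → ℕ) (u : V) : ℕ :=
  ∑ v ∈ G.neighborFinset u, c v

/-- `c` is a majority additive `k`-coloring of `G`: it maps `V(G)` to `{1, …, k}`, and there is no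
vertex `u` of degree at least `2` and no `s` such that `s_c(v) = s` for more than half the
neighbors `v` of `u`. (All sums are natural numbers, so it suffices that `s` ranges over `ℕ`.) -/
structure IsMajorityAdditiveColoring (k : ℕ) (c : V → ℕ) : Prop where
  one_le : ∀ v, 1 ≤ c v
  le : ∀ v, c v ≤ k
  majority : ¬ ∃ (u : V) (s : ℕ), 2 ≤ G.degree u ∧
    G.degree u < 2 * #{v ∈ G.neighborFinset u | neighborSum G c v = s}

/-- `G` is good: there are no vertex `u` of degree larger than `1` and no set `R` of more than half
the neighbors of `u` such that all vertices in `R` have the same neighborhood. -/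
def IsGood : Prop :=
  ¬ ∃ (u : V) (R : Finset V), R ⊆ G.neighborFinset u ∧ G.degree u < 2 * #R ∧ 1 < G.degree u ∧
    ∀ v ∈ R, ∀ w ∈ R, G.neighborSet v = G.neighborSet w

/-- The smallest positive integer `k` such that `G` has a majority additive `k`-coloring,
with value `⊤` if there is no such `k`. -/
noncomputable def chromaticNumber : ℕ∞ :=
  ⨅ k ∈ {k : ℕ | 0 < k ∧ ∃ c : V → ℕ, IsMajorityAdditiveColoring G k c}, (k : ℕ∞)

/-- The private neighbor condition: for every vertex `u` of degree at least `2`, every neighbor `v`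
of `u` has a neighbor `w` with `N_G(w) ∩ N_G[u] = {v}`. -/
def PrivateNeighborCondition : Prop :=
  ∀ u : V, 2 ≤ G.degree u → ∀ v ∈ G.neighborSet u, ∃ w ∈ G.neighborSet v,
    G.neighborSet w ∩ insert u (G.neighborSet u) = {v}

end MajorityAdditive

/-! Goodness is immediate: two vertices with the same neighborhood cannot have private neighbors.
For the coloring, take k = (2a)^3 colors uniformly at random. If a set R of neighbors of u has equal
sums, then fixing r in R and all colors except those of the private neighbors of R \ {r} forces the
latter. Hence this has probability at most k^-(|R|-1) (`card_constant_neighborSum_mul_le`), and a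
union bound over at most 2^d sets R makes u, of degree d, bad with probability at most a^-d. Only
private neighbors are resampled, so a lopsided local lemma with about Δ^3 dependencies applies once
a^d ≥ 4(Δ^3+1). The logarithmic degree condition allows such an a independent of G. -/

namespace MajorityAdditive

/-! ### The local lemma by counting -/

section LocalLemma

variable {Ω ι : Type*} [Fintype Ω]

open Classical in
/-- The outcomes avoiding all events `A i` with `i ∈ S`. -/
noncomputable def avoiding (A : ι → Finset Ω) (S : Finset ι) : Finset Ω :=
  {ω | ∀ i ∈ S, ω ∉ A i}

theorem mem_avoiding {A : ι → Finset Ω} {S : Finset ι} {ω : Ω} :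
    ω ∈ avoiding A S ↔ ∀ i ∈ S, ω ∉ A i := by
  simp [avoiding]

-- Induction on S. Without the events in Γ i, the conditional probability of A i is at most 1/(4D).
-- By induction the at most D events put back each have conditional probability at most 1/(2D), so
-- they remove at most half of the outcomes and the bound at most doubles.
open Classical in
theorem card_inter_avoiding_le [DecidableEq Ω] (A : ι → Finset Ω) (Γ : ι → Finset ι) (D : ℕ)
    (hΓ : ∀ i, #(Γ i) ≤ D)
    (h : ∀ i S, Disjoint S (Γ i) → 4 * D * #(A i ∩ avoiding A S) ≤ #(avoiding A S))
    (S : Finset ι) : ∀ i, 2 * D * #(A i ∩ avoiding A S) ≤ #(avoiding A S) := by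
  induction S using Finset.strongInduction with
  | H S ih =>
  intro i
  by_cases hS : Disjoint S (Γ i)
  · have := h i S hS
    nlinarith
  have hsub : S \ Γ i ⊂ S := by
    refine Finset.ssubset_iff_subset_ne.2 ⟨Finset.sdiff_subset, fun he => hS ?_⟩
    exact Finset.sdiff_eq_self_iff_disjoint.1 he
  have h1 := h i (S \ Γ i) Finset.sdiff_disjoint
  have hmono : avoiding A S ⊆ avoiding A (S \ Γ i) := fun ω hω =>
    mem_avoiding.2 fun j hj => mem_avoiding.1 hω j (Finset.sdiff_subset hj)
  have h2 : #(A i ∩ avoiding A S) ≤ #(A i ∩ avoiding A (S \ Γ i)) :=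
    Finset.card_le_card (Finset.inter_subset_inter_left hmono)
  have hcover : avoiding A (S \ Γ i) ⊆
      avoiding A S ∪ (S ∩ Γ i).biUnion fun j => A j ∩ avoiding A (S \ Γ i) := by
    intro ω hω
    by_cases hω' : ω ∈ avoiding A S
    · exact Finset.mem_union_left _ hω'
    · refine Finset.mem_union_right _ ?_
      rw [mem_avoiding] at hω'
      push Not at hω'
      obtain ⟨j, hj, hjA⟩ := hω'
      have hjΓ : j ∈ Γ i := by
        by_contra hn
        exact mem_avoiding.1 hω j (Finset.mem_sdiff.2 ⟨hj, hn⟩) hjA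
      exact Finset.mem_biUnion.2
        ⟨j, Finset.mem_inter.2 ⟨hj, hjΓ⟩, Finset.mem_inter.2 ⟨hjA, hω⟩⟩
  have h3 : #(avoiding A (S \ Γ i)) ≤
      #(avoiding A S) + ∑ j ∈ S ∩ Γ i, #(A j ∩ avoiding A (S \ Γ i)) :=
    (Finset.card_le_card hcover).trans
      ((Finset.card_union_le _ _).trans (Nat.add_le_add_left Finset.card_biUnion_le _))
  have h4 : 2 * D * ∑ j ∈ S ∩ Γ i, #(A j ∩ avoiding A (S \ Γ i)) ≤
      D * #(avoiding A (S \ Γ i)) := by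
    rw [Finset.mul_sum]
    refine (Finset.sum_le_card_nsmul _ _ _ fun j _ => ih _ hsub j).trans ?_
    rw [smul_eq_mul]
    exact Nat.mul_le_mul_right _ ((Finset.card_le_card Finset.inter_subset_right).trans (hΓ i))
  rcases Nat.eq_zero_or_pos D with rfl | hD
  · simp
  have h5 : 2 * ∑ j ∈ S ∩ Γ i, #(A j ∩ avoiding A (S \ Γ i)) ≤ #(avoiding A (S \ Γ i)) :=
    Nat.le_of_mul_le_mul_left (by linarith) hD
  have h6 : 4 * D * #(A i ∩ avoiding A S) ≤ 4 * D * #(A i ∩ avoiding A (S \ Γ i)) :=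
    Nat.mul_le_mul_left _ h2
  linarith

open Classical in
/-- A symmetric, counting form of the (lopsided) Lovász local lemma. -/
theorem exists_forall_notMem_of_local [DecidableEq Ω] [Fintype ι] [Nonempty Ω] (A : ι → Finset Ω)
    (Γ : ι → Finset ι) (D : ℕ) (hD : 0 < D) (hΓ : ∀ i, #(Γ i) ≤ D)
    (h : ∀ i S, Disjoint S (Γ i) → 4 * D * #(A i ∩ avoiding A S) ≤ #(avoiding A S)) :
    ∃ ω, ∀ i, ω ∉ A i := by
  have key : ∀ S : Finset ι, (avoiding A S).Nonempty := by
    intro S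
    induction S using Finset.induction_on with
    | empty =>
      obtain ⟨ω⟩ := ‹Nonempty Ω›
      exact ⟨ω, mem_avoiding.2 (by simp)⟩
    | insert i S _ ih =>
      have h1 := card_inter_avoiding_le A Γ D hΓ h S i
      have h2 : #(A i ∩ avoiding A S) < #(avoiding A S) := by
        have := ih.card_pos
        nlinarith
      obtain ⟨ω, hω, hωn⟩ := Finset.exists_mem_notMem_of_card_lt_card h2
      refine ⟨ω, mem_avoiding.2 fun j hj => ?_⟩
      rcases Finset.mem_insert.1 hj with rfl | hj
      · exact fun hA => hωn (Finset.mem_inter.2 ⟨hA, hω⟩)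
      · exact mem_avoiding.1 hω j hj
  obtain ⟨ω, hω⟩ := key Finset.univ
  exact ⟨ω, fun i => mem_avoiding.1 hω i (Finset.mem_univ i)⟩

end LocalLemma

/-! ### Random colorings and private neighbors -/

section Coloring

variable {V : Type*} [Fintype V] {G : SimpleGraph V} [DecidableRel G.Adj]

/-- The coloring with values in `{1, …, k}` given by a function into `Fin k`. -/
def shiftedColoring {k : ℕ} (c : V → Fin k) (v : V) : ℕ := c v + 1

theorem PrivateNeighborCondition.isGood (hG : PrivateNeighborCondition G) : IsGood G := by
  rintro ⟨u, R, hR, hcard, hdeg, hN⟩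
  obtain ⟨v, hv, v', hv', hne⟩ := Finset.one_lt_card.1 (show 1 < #R by omega)
  have hvu : v ∈ G.neighborSet u := by simpa using hR hv
  have hvu' : v' ∈ G.neighborSet u := by simpa using hR hv'
  obtain ⟨w, hw, hpriv⟩ := hG u hdeg v hvu
  have hw' : w ∈ G.neighborSet v' := hN v hv v' hv' ▸ hw
  have : v' ∈ G.neighborSet w ∩ insert u (G.neighborSet u) :=
    ⟨SimpleGraph.Adj.symm hw', Set.mem_insert_of_mem _ hvu'⟩
  rw [hpriv] at this
  exact hne this.symm

/-- `w` assigns to each vertex of `T` a neighbor that is adjacent to no other vertex of `T`. -/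
def IsPrivateOn (G : SimpleGraph V) (T : Finset V) (w : V → V) : Prop :=
  ∀ v ∈ T, ∀ v' ∈ T, G.Adj v' (w v) ↔ v' = v

theorem neighborSum_congr {c c' : V → ℕ} {v : V} (h : ∀ x, G.Adj v x → c x = c' x) :
    neighborSum G c v = neighborSum G c' v :=
  Finset.sum_congr rfl fun x hx => h x (by simpa using hx)

theorem eq_of_neighborSum_eq {c c' : V → ℕ} {v y : V} (hy : G.Adj v y)
    (h : ∀ x, G.Adj v x → x ≠ y → c x = c' x)
    (hs : neighborSum G c v = neighborSum G c' v) : c y = c' y := by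
  classical
  unfold neighborSum at hs
  have hy' : y ∈ G.neighborFinset v := by simpa using hy
  rw [← Finset.add_sum_erase _ _ hy', ← Finset.add_sum_erase _ _ hy'] at hs
  have : ∑ x ∈ (G.neighborFinset v).erase y, c x = ∑ x ∈ (G.neighborFinset v).erase y, c' x :=
    Finset.sum_congr rfl fun x hx => by
      rw [Finset.mem_erase, SimpleGraph.mem_neighborFinset] at hx
      exact h x hx.2 hx.1
  omega

open Classical in
/-- Recoloring private neighbors shows that few colorings give all vertices of `R` the same
neighbor sum. -/
theorem card_constant_neighborSum_mul_le {k : ℕ} {R : Finset V} {w : V → V}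
    (hw : IsPrivateOn G R w) {r : V} (hr : r ∈ R) (E : Finset (V → Fin k))
    (hE : ∀ c ∈ E, ∀ c' : V → Fin k, (∀ x ∉ R.image w, c' x = c x) → c' ∈ E) :
    #{c ∈ E | ∀ v ∈ R, neighborSum G (shiftedColoring c) v =
        neighborSum G (shiftedColoring c) r} * k ^ (#R - 1) ≤ #E := by
  -- The private neighbor of r keeps its color, so the sum at r survives the recoloring and serves
  -- as the reference value.
  let T := R.erase r
  have hT : ∀ v : T, (v : V) ∈ R := fun v => Finset.mem_of_mem_erase v.2
  have hinj : Function.Injective fun v : T => w v := by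
    intro v v' (h : w v = w v')
    have h1 := (hw v (hT v) v (hT v)).2 rfl
    rw [h] at h1
    exact Subtype.ext ((hw v' (hT v') v (hT v)).1 h1)
  have hcard : #((Finset.univ : Finset (T → Fin k))) = k ^ (#R - 1) := by
    rw [Finset.card_univ, Fintype.card_fun, Fintype.card_fin, Fintype.card_coe,
      Finset.card_erase_of_mem hr]
  rw [← hcard, ← Finset.card_product]
  -- Overwrite the colors of the private neighbors of T by f. This loses nothing: the sum at r is
  -- still visible, and it determines each overwritten color through the sum at v.
  refine Finset.card_le_card_of_injOn
    (fun p => Function.extend (fun v : T => w v) p.2 p.1) ?_ ?_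
  · rintro ⟨c, f⟩ hc
    simp only [Finset.coe_product, Set.mem_prod, Finset.mem_coe, Finset.mem_filter] at hc
    refine hE c hc.1.1 _ fun x hx => Function.extend_apply' _ _ _ ?_
    rintro ⟨v, rfl⟩
    exact hx (Finset.mem_image_of_mem _ (hT v))
  · rintro ⟨c, f⟩ hc ⟨c', f'⟩ hc' heq
    simp only [Finset.coe_product, Set.mem_prod, Finset.mem_coe, Finset.mem_filter] at hc hc'
    replace hc := hc.1.2
    replace hc' := hc'.1.2
    replace heq : ∀ x, Function.extend (fun v : T => w v) f c x =
        Function.extend (fun v : T => w v) f' c' x := fun x => congrFun heq x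
    have hff : f = f' := by
      funext v
      simpa [hinj.extend_apply] using heq (w v)
    have hoff : ∀ x, (∀ v : T, w v ≠ x) → c x = c' x := by
      intro x hx
      have h := heq x
      rwa [Function.extend_apply' _ _ _ (by simpa using hx),
        Function.extend_apply' _ _ _ (by simpa using hx)] at h
    have hoff' : ∀ x, (∀ v : T, w v ≠ x) → shiftedColoring c x = shiftedColoring c' x := by
      intro x hx
      simp [shiftedColoring, hoff x hx]
    have hr' : neighborSum G (shiftedColoring c) r = neighborSum G (shiftedColoring c') r := by
      refine neighborSum_congr fun x hx => hoff' x fun v hv => ?_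
      rw [← hv] at hx
      exact Finset.ne_of_mem_erase v.2 ((hw v (hT v) r hr).1 hx).symm
    have hcc : c = c' := by
      funext x
      by_cases hx : ∃ v : T, w v = x
      · obtain ⟨v, rfl⟩ := hx
        have hs := (hc v (hT v)).trans (hr'.trans (hc' v (hT v)).symm)
        have := eq_of_neighborSum_eq ((hw v (hT v) v (hT v)).2 rfl) (fun x hx hne =>
          hoff' x fun v' hv' => by
            rw [← hv'] at hx hne
            exact hne (by rw [(hw v' (hT v') v (hT v)).1 hx])) hs
        simp only [shiftedColoring, add_left_inj] at this
        exact Fin.ext this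
      · exact hoff x (by simpa using hx)
    rw [hcc, hff]

open Classical in
/-- The colorings that violate the majority condition at `u`. -/
noncomputable def violating (G : SimpleGraph V) [DecidableRel G.Adj] (k : ℕ) (u : V) :
    Finset (V → Fin k) :=
  {c | 2 ≤ G.degree u ∧ ∃ s, G.degree u <
    2 * #{v ∈ G.neighborFinset u | neighborSum G (shiftedColoring c) v = s}}

-- Union bound over the neighbor sets of the least majority size.
open Classical in
theorem card_violating_inter_mul_le {k : ℕ} {u : V} {w : V → V}
    (hw : IsPrivateOn G (G.neighborFinset u) w) (E : Finset (V → Fin k))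
    (hE : ∀ c ∈ E, ∀ c' : V → Fin k,
      (∀ x ∉ (G.neighborFinset u).image w, c' x = c x) → c' ∈ E) :
    #(violating G k u ∩ E) * k ^ (G.degree u / 2) ≤ 2 ^ G.degree u * #E := by
  let P := (G.neighborFinset u).powersetCard (G.degree u / 2 + 1)
  let B : Finset V → Finset (V → Fin k) := fun R =>
    {c ∈ E | ∀ v ∈ R, ∀ r ∈ R, neighborSum G (shiftedColoring c) v =
        neighborSum G (shiftedColoring c) r}
  have hcover : violating G k u ∩ E ⊆ P.biUnion B := by
    intro c hc
    simp only [violating, Finset.mem_inter, Finset.mem_filter, Finset.mem_univ, true_and] at hc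
    obtain ⟨⟨-, s, hs⟩, hcE⟩ := hc
    obtain ⟨R, hR, hRc⟩ := Finset.exists_subset_card_eq
      (show G.degree u / 2 + 1 ≤
        #{v ∈ G.neighborFinset u | neighborSum G (shiftedColoring c) v = s} by omega)
    refine Finset.mem_biUnion.2 ⟨R, Finset.mem_powersetCard.2
      ⟨hR.trans (Finset.filter_subset _ _), hRc⟩, Finset.mem_filter.2 ⟨hcE, fun v hv r hr => ?_⟩⟩
    rw [(Finset.mem_filter.1 (hR hv)).2, (Finset.mem_filter.1 (hR hr)).2]
  have hB : ∀ R ∈ P, #(B R) * k ^ (G.degree u / 2) ≤ #E := by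
    intro R hR
    obtain ⟨hsub, hcard⟩ := Finset.mem_powersetCard.1 hR
    obtain ⟨r, hr⟩ := Finset.card_pos.1 (show 0 < #R by omega)
    have h := card_constant_neighborSum_mul_le
      (fun v hv v' hv' => hw v (hsub hv) v' (hsub hv')) hr E
      (fun c hc c' hcc' => hE c hc c' fun x hx => hcc' x fun hx' =>
        hx (Finset.image_subset_image hsub hx'))
    rw [hcard, Nat.add_sub_cancel] at h
    refine (Nat.mul_le_mul_right _ (Finset.card_le_card ?_)).trans h
    intro c hc
    rw [Finset.mem_filter] at hc ⊢
    exact ⟨hc.1, fun v hv => hc.2 v hv r hr⟩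
  have hP : #P ≤ 2 ^ G.degree u := by
    rw [Finset.card_powersetCard, SimpleGraph.card_neighborFinset_eq_degree]
    exact Nat.choose_le_two_pow _ _
  calc #(violating G k u ∩ E) * k ^ (G.degree u / 2)
      ≤ (∑ R ∈ P, #(B R)) * k ^ (G.degree u / 2) :=
        Nat.mul_le_mul_right _ ((Finset.card_le_card hcover).trans Finset.card_biUnion_le)
    _ = ∑ R ∈ P, #(B R) * k ^ (G.degree u / 2) := Finset.sum_mul _ _ _
    _ ≤ #P * #E := Finset.sum_le_card_nsmul _ _ _ hB
    _ ≤ 2 ^ G.degree u * #E := Nat.mul_le_mul_right _ hP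

theorem violating_congr {k : ℕ} {j : V} {c c' : V → Fin k}
    (h : ∀ v, G.Adj j v → ∀ x, G.Adj v x → c x = c' x) :
    c ∈ violating G k j ↔ c' ∈ violating G k j := by
  have : ∀ s, {v ∈ G.neighborFinset j | neighborSum G (shiftedColoring c) v = s} =
      {v ∈ G.neighborFinset j | neighborSum G (shiftedColoring c') v = s} := fun s =>
    Finset.filter_congr fun v hv => by
      rw [neighborSum_congr (c' := shiftedColoring c') fun x hx => by
        simp [shiftedColoring, h v (by simpa using hv) x hx]]
  simp only [violating, Finset.mem_filter, Finset.mem_univ, true_and, this]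

theorem PrivateNeighborCondition.exists_isPrivateOn (hG : PrivateNeighborCondition G) (u : V)
    (hu : 2 ≤ G.degree u) : ∃ w : V → V, IsPrivateOn G (G.neighborFinset u) w := by
  have : ∀ v, ∃ w, v ∈ G.neighborSet u → w ∈ G.neighborSet v ∧
      G.neighborSet w ∩ insert u (G.neighborSet u) = {v} := by
    intro v
    by_cases hv : v ∈ G.neighborSet u
    · obtain ⟨w, hw⟩ := hG u hu v hv
      exact ⟨w, fun _ => hw⟩
    · exact ⟨v, fun h => absurd h hv⟩
  choose w hw using this
  refine ⟨w, fun v hv v' hv' => ?_⟩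
  rw [SimpleGraph.mem_neighborFinset] at hv hv'
  obtain ⟨h1, h2⟩ := hw v hv
  constructor
  · intro h
    have : v' ∈ G.neighborSet (w v) ∩ insert u (G.neighborSet u) :=
      ⟨h.symm, Set.mem_insert_of_mem _ hv'⟩
    rwa [h2] at this
  · rintro rfl
    exact h1

theorem exists_isMajorityAdditiveColoring (hG : PrivateNeighborCondition G) {a : ℕ} (ha : 0 < a)
    (h : ∀ u, 2 ≤ G.degree u → 4 * (G.maxDegree ^ 3 + 1) ≤ a ^ G.degree u) :
    ∃ c : V → ℕ, IsMajorityAdditiveColoring G ((2 * a) ^ 3) c := by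
  classical
  obtain ⟨k, hk⟩ : ∃ k, k = (2 * a) ^ 3 := ⟨_, rfl⟩
  rw [← hk]
  have : NeZero k := ⟨by rw [hk]; positivity⟩
  have hex : ∀ u, ∃ w : V → V, 2 ≤ G.degree u → IsPrivateOn G (G.neighborFinset u) w := by
    intro u
    by_cases hu : 2 ≤ G.degree u
    · obtain ⟨w, hw⟩ := hG.exists_isPrivateOn u hu
      exact ⟨w, fun _ => hw⟩
    · exact ⟨id, fun h => absurd h hu⟩
  choose w hw using hex
  -- The vertices two steps from a private neighbor of u: only their events can see the resampled
  -- colors.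
  let Γ : V → Finset V := fun u =>
    ((G.neighborFinset u).image (w u)).biUnion fun x =>
      (G.neighborFinset x).biUnion fun v => G.neighborFinset v
  have hdeg : ∀ v, #(G.neighborFinset v) ≤ G.maxDegree := fun v => by
    rw [SimpleGraph.card_neighborFinset_eq_degree]
    exact G.degree_le_maxDegree v
  have hΓ : ∀ u, #(Γ u) ≤ G.maxDegree ^ 3 + 1 := by
    intro u
    have h1 : ∀ x, #((G.neighborFinset x).biUnion fun v => G.neighborFinset v) ≤
        G.maxDegree * G.maxDegree := fun x =>
      (Finset.card_biUnion_le_card_mul _ _ _ fun v _ => hdeg v).trans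
        (Nat.mul_le_mul_right _ (hdeg x))
    have h2 : #(Γ u) ≤ G.maxDegree * (G.maxDegree * G.maxDegree) :=
      (Finset.card_biUnion_le_card_mul _ _ _ fun x _ => h1 x).trans
        (Nat.mul_le_mul_right _ (Finset.card_image_le.trans (hdeg u)))
    calc #(Γ u) ≤ G.maxDegree * (G.maxDegree * G.maxDegree) := h2
      _ ≤ G.maxDegree ^ 3 + 1 := by rw [pow_succ, pow_two, mul_assoc]; omega
  obtain ⟨c, hc⟩ := exists_forall_notMem_of_local (violating G k) Γ (G.maxDegree ^ 3 + 1)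
    (Nat.succ_pos _) hΓ (by
    intro u S hS
    by_cases hu : 2 ≤ G.degree u
    swap
    · have : violating G k u = ∅ := by simp [violating, hu]
      simp [this]
    have h1 := card_violating_inter_mul_le (k := k) (hw u hu) (avoiding (violating G k) S) (by
      intro c hc c' hcc'
      refine mem_avoiding.2 fun j hj => ?_
      rw [violating_congr (c' := c)]
      · exact mem_avoiding.1 hc j hj
      · intro v hv x hx
        refine hcc' x fun hxw => Finset.disjoint_left.1 hS hj ?_
        refine Finset.mem_biUnion.2 ⟨x, hxw, Finset.mem_biUnion.2 ⟨v, ?_, ?_⟩⟩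
        · simpa using hx.symm
        · simpa using hv.symm)
    -- The cube in k pays for rounding: d ≤ 3⌊d/2⌋ for d ≥ 2, with equality at d = 3.
    have h2 : (2 * a) ^ G.degree u ≤ k ^ (G.degree u / 2) := by
      rw [hk, ← pow_mul]
      exact Nat.pow_le_pow_right (by omega) (by omega)
    have h3 := (Nat.mul_le_mul_left _ h2).trans h1
    rw [mul_pow, mul_left_comm] at h3
    have h4 := Nat.le_of_mul_le_mul_left h3 (by positivity)
    calc _ ≤ a ^ G.degree u * #(violating G k u ∩ avoiding (violating G k) S) :=
          Nat.mul_le_mul_right _ (h u hu)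
      _ ≤ _ := by rwa [mul_comm])
  refine ⟨shiftedColoring c, fun v => Nat.succ_pos _, fun v => (c v).2, ?_⟩
  rintro ⟨u, s, hu, hs⟩
  exact hc u (by simpa [violating] using ⟨hu, s, hs⟩)

theorem exists_bound_le_pow_degree (ε : ℝ) (hε : 0 < ε) (Δ₀ : ℕ) : ∃ a : ℕ, 0 < a ∧
    ∀ Δ δ d : ℕ, (Δ₀ ≤ Δ → ε * Real.log Δ ≤ δ) → δ ≤ d → d ≤ Δ → 2 ≤ d →
      4 * (Δ ^ 3 + 1) ≤ a ^ d := by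
  obtain ⟨b, hb⟩ := exists_nat_ge (Real.exp (3 / ε))
  have hb0 : 0 < b := by
    have := (Real.exp_pos (3 / ε)).trans_le hb
    exact_mod_cast this
  -- Δ₀ ^ 3 handles Δ < Δ₀, b ≥ exp(3/ε) handles Δ ≥ Δ₀, and 8 absorbs 4(Δ^3+1) ≤ 8Δ^3.
  refine ⟨8 * (Δ₀ ^ 3 + b), by omega, fun Δ δ d h hδ hd h2 => ?_⟩
  have hΔ : 1 ≤ Δ ^ 3 := Nat.one_le_pow _ _ (by omega)
  have h8 : 8 ≤ 8 ^ d := Nat.le_self_pow (by omega) 8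
  have key : Δ ^ 3 ≤ (Δ₀ ^ 3 + b) ^ d := by
    rcases lt_or_ge Δ Δ₀ with hlt | hge
    · calc Δ ^ 3 ≤ Δ₀ ^ 3 := Nat.pow_le_pow_left hlt.le 3
        _ ≤ Δ₀ ^ 3 + b := Nat.le_add_right _ _
        _ ≤ _ := Nat.le_self_pow (by omega) _
    · refine le_trans ?_ (Nat.pow_le_pow_left (Nat.le_add_left b _) d)
      have hΔ0 : (0 : ℝ) < Δ := by exact_mod_cast (show 0 < Δ by omega)
      have hlog : Real.log Δ ≤ d / ε := by
        rw [le_div_iff₀ hε, mul_comm]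
        exact (h hge).trans (by exact_mod_cast hδ)
      have : (Δ : ℝ) ^ 3 ≤ (b : ℝ) ^ d := by
        calc (Δ : ℝ) ^ 3 = Real.exp (3 * Real.log Δ) := by
              rw [← Real.exp_log hΔ0, ← Real.exp_nat_mul, Real.log_exp]; norm_num
          _ ≤ Real.exp (d * (3 / ε)) := by
              apply Real.exp_le_exp.2
              calc 3 * Real.log Δ ≤ 3 * (d / ε) := by linarith
                _ = d * (3 / ε) := by ring
          _ = Real.exp (3 / ε) ^ d := Real.exp_nat_mul _ _
          _ ≤ (b : ℝ) ^ d := by gcongr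
      exact_mod_cast this
  calc 4 * (Δ ^ 3 + 1) ≤ 8 * Δ ^ 3 := by omega
    _ ≤ 8 ^ d * (Δ₀ ^ 3 + b) ^ d := Nat.mul_le_mul h8 key
    _ = _ := (mul_pow _ _ _).symm

theorem chromaticNumber_le {k : ℕ} (hk : 0 < k) {c : V → ℕ}
    (hc : IsMajorityAdditiveColoring G k c) : chromaticNumber G ≤ k :=
  iInf₂_le (f := fun k (_ : k ∈ {k : ℕ | 0 < k ∧ ∃ c : V → ℕ, IsMajorityAdditiveColoring G k c}) =>
    (k : ℕ∞)) k ⟨hk, c, hc⟩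

end Coloring

end MajorityAdditive

theorem mainTheorem5 (ε : ℝ) (hε : 0 < ε) (Δ₀ : ℕ) :
    ∃ C : ℕ, ∀ (V : Type*) [Fintype V] (G : SimpleGraph V) [DecidableRel G.Adj],
      MajorityAdditive.PrivateNeighborCondition G →
      (Δ₀ ≤ G.maxDegree → ε * Real.log (G.maxDegree : ℝ) ≤ (G.minDegree : ℝ)) →
      MajorityAdditive.IsGood G ∧ MajorityAdditive.chromaticNumber G ≤ (C : ℕ∞) := by
  obtain ⟨a, ha, hbound⟩ := MajorityAdditive.exists_bound_le_pow_degree ε hε Δ₀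
  refine ⟨(2 * a) ^ 3, fun V _ G _ hG hdeg => ⟨hG.isGood, ?_⟩⟩
  obtain ⟨c, hc⟩ := MajorityAdditive.exists_isMajorityAdditiveColoring hG ha fun u hu =>
    hbound _ _ _ hdeg (G.minDegree_le_degree u) (G.degree_le_maxDegree u) hu
  exact MajorityAdditive.chromaticNumber_le (by positivity) hc
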